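/- For real numbers $\alpha,\beta>-1$ consider the operator $$D=\partial_t-\alpha(1-t)^{-1}+\beta(1+t)^{-1}:\ \mathbb C[t]\to\mathbb C(t)$$ related to the Jacobi polynomials, and put ${\rm Im}'D:=\mathbb C[t]\cap D(\mathbb C[t])$. For a subset $V\subseteq\mathbb C[t]$ let $$\mathfrak r(V):=\{a\in\mathbb C[t] : \text{there is } N\in\mathbb N \text{ with } a^m\in V \text{ for all } m\ge N\}.$$ We say that the Strong Image Conjecture (SIC) holds for $D$ if $1\notin{\rm Im}'D$ implies $\mathfrak r({\rm Im}'D)=\{0\}$. Here $\mathbb N=\{0,1,2,\dots\}$. Assume that $\alpha$ and $\beta$ are not both zero. (i) If $\alpha,\beta\in\mathbb N$, then the SIC holds for $D$; moreover, if $\alpha\neq0$ and $\beta\neq0$, then $\mathfrak r({\rm Im}'D)=\{0\}$. (ii) If $\alpha=\beta=\lambda-\frac12$ with $\lambda\in\frac12\mathbb N$, then $\mathfrak r({\rm Im}'D)=\{0\}$; so the SIC holds for $D$. In particular, the SIC holds for the operators $D$ with $\alpha=\beta=\lambda-\frac12$ related to the Gegenbauer polynomials with $\lambda\in\frac12\mathbb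 N$, $\lambda\ge1$, and for those related to the Chebyshev polynomials of the first kind ($\lambda=0$) and of the second kind ($\lambda=1$). -/

import Mathlib

open Polynomial

/-- The radical `𝔯(V)` of a subset `V` of a commutative algebra `A`: all `a ∈ A` such that
`a ^ m ∈ V` for all sufficiently large `m`. -/
def powerRadical {A : Type*} [CommRing A] (V : Set A) : Set A :=
  {a | ∃ N : ℕ, ∀ m : ℕ, N ≤ m → a ^ m ∈ V}

/-- `Im' D = ℂ[t] ∩ D(ℂ[t])` for a `ℂ`-linear operator `D : ℂ[t] → ℂ(t)`, as a subspace of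
`ℂ[t]`: the polynomials `f` whose image in `ℂ(t)` is of the form `D h`, with `h ∈ ℂ[t]`. -/
noncomputable def imPrime (D : ℂ[X] →ₗ[ℂ] RatFunc ℂ) : Submodule ℂ ℂ[X] :=
  (LinearMap.range D).comap (IsScalarTower.toAlgHom ℂ ℂ[X] (RatFunc ℂ)).toLinearMap

/-- The operator `D = ∂_t - α (1 - t)⁻¹ + β (1 + t)⁻¹` from `ℂ[t]` to `ℂ(t)`. -/
noncomputable def jacobiOperator (α β : ℝ) : ℂ[X] →ₗ[ℂ] RatFunc ℂ where
  toFun h :=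
    algebraMap ℂ[X] (RatFunc ℂ) (derivative h)
      - RatFunc.C (α : ℂ) * (1 - RatFunc.X)⁻¹ * algebraMap ℂ[X] (RatFunc ℂ) h
      + RatFunc.C (β : ℂ) * (1 + RatFunc.X)⁻¹ * algebraMap ℂ[X] (RatFunc ℂ) h
  map_add' f g := by
    simp only [map_add]
    ring
  map_smul' c f := by
    simp only [smul_eq_C_mul, derivative_C_mul, map_mul, RatFunc.algebraMap_C,
      RatFunc.smul_eq_C_mul, RingHom.id_apply]
    ring

/-- The operator attached to the Gegenbauer polynomials with parameter `lam`, that is, to the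
Jacobi polynomials with `α = β = lam - 1/2`. The Chebyshev polynomials of the first and of the
second kind are the cases `lam = 0` and `lam = 1`. -/
noncomputable def gegenbauerOperator (lam : ℝ) : ℂ[X] →ₗ[ℂ] RatFunc ℂ :=
  jacobiOperator (lam - 1 / 2) (lam - 1 / 2)

/-- The assertion of the Strong Image Conjecture for the operator `D`:
if `1 ∉ Im' D`, then `𝔯(Im' D) = {0}`. -/
def StrongImageConjectureFor (D : ℂ[X] →ₗ[ℂ] RatFunc ℂ) : Prop :=
  (1 : ℂ[X]) ∉ imPrime D → powerRadical (imPrime D : Set ℂ[X]) = {0}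

/-!
The Strong Image Conjecture is proved for all real `α, β > -1`: if `f` is not constant and
`f ^ m ∈ V := Im' D` for all large `m`, then `1 ∈ V`. For constants `f ≠ 0` this is clear.

The idea is a comparison of exponents of a Fuchsian differential equation at `z = 0`. In the model
case `V` is the kernel of `g ↦ ∫ g w` over `[-1, 1]`, with `w = (1 - t) ^ α (1 + t) ^ β`, and the
generating function `∑ z ^ (-k-1) ∫ f ^ k w` of the moments is the integral of `w / (z - f)`. Its
exponents at `z = 0` exceed `-1`, while vanishing of almost all moments makes it a polynomial in
`1 / z` without constant term. Both can hold only if it is zero, so that the moment with `k = 0`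
vanishes too.

The proof below is an algebraic form of this argument, without integrals. Let `J n` be the set of
`g ∈ ℂ[t]` with `f ^ k g ∈ V` for all `k ≥ n`, that is, with a pole of order at most `n`. These sets
form an ascending chain of `ℂ[f]`-submodules of the Noetherian module `ℂ[t]`; let `n` be the least
index from which it is constant. In place of `z d/dz` stands `S g = D ((1 - t ^ 2) b g)`, where
`(1 - t ^ 2) b = f h(f) / f'` for a polynomial `h` with `h(0) ≠ 0` that clears the denominators
(`exists_mul_derivative_mul_eq_mul_comp`). An integration by parts (`jacobiWeighted_add_mem`) shows
that `S + (n - 1) h(0)` maps `J n` into `J (n - 1)` if `n ≥ 1`. Since `J (n - 1) ≠ J n` contains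
`J n ∩ f ℂ[t]`, this operator is not surjective on the image of `J n` in `ℂ[t] / (f)`, so `S` has
the eigenvalue `-(n - 1) h(0)` there. By a local computation at the zeros of `f`, all eigenvalues
of `S` on `ℂ[t] / (f)` are positive multiples of `h(0)` (`exists_eigenvalue_eq_of_dvd`); this is
where `α, β > -1` enters. Hence `n = 0`, and `1 ∈ J 0` gives `1 ∈ V` (`one_mem_of_pow_mem`).

Finally, `1 ∉ Im' D` if `α` and `β` are nonzero, by comparison of degrees
(`one_notMem_imPrime_jacobiOperator`).
-/

/-! ### The Jacobi operator without denominators -/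

/-- The operator `y ↦ D ((1 - t ^ 2) y)` for `D = ∂_t - α (1 - t)⁻¹ + β (1 + t)⁻¹`, written without
denominators so that it maps `ℂ[t]` to itself. -/
noncomputable def jacobiWeighted (α β : ℝ) : ℂ[X] →ₗ[ℂ] ℂ[X] where
  toFun y := derivative ((1 - X ^ 2) * y) - C (α : ℂ) * (1 + X) * y + C (β : ℂ) * (1 - X) * y
  map_add' y z := by
    simp only [mul_add, map_add]
    ring
  map_smul' c y := by
    simp only [smul_eq_C_mul, RingHom.id_apply, mul_left_comm _ (C c), derivative_C_mul]
    ring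

theorem jacobiWeighted_apply (α β : ℝ) (y : ℂ[X]) :
    jacobiWeighted α β y =
      derivative ((1 - X ^ 2) * y) - C (α : ℂ) * (1 + X) * y + C (β : ℂ) * (1 - X) * y :=
  rfl

theorem jacobiWeighted_mul (α β : ℝ) (x y : ℂ[X]) :
    jacobiWeighted α β (x * y) =
      x * jacobiWeighted α β y + derivative x * (1 - X ^ 2) * y := by
  simp only [jacobiWeighted_apply, derivative_mul]
  ring

/-- Membership in `Im' D` with the denominators cleared, hence an identity in `ℂ[t]`. -/
theorem mem_imPrime_jacobiOperator (α β : ℝ) (p : ℂ[X]) :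
    p ∈ imPrime (jacobiOperator α β) ↔ ∃ h : ℂ[X],
      (1 - X ^ 2) * derivative h - C (α : ℂ) * (1 + X) * h + C (β : ℂ) * (1 - X) * h
        = (1 - X ^ 2) * p := by
  have inj := RatFunc.algebraMap_injective ℂ
  have h1 : (1 - RatFunc.X : RatFunc ℂ) ≠ 0 := by
    have : (1 - X : ℂ[X]) ≠ 0 := fun h => by simpa using congrArg (eval 0) h
    simpa using inj.ne this
  have h2 : (1 + RatFunc.X : RatFunc ℂ) ≠ 0 := by
    have : (1 + X : ℂ[X]) ≠ 0 := fun h => by simpa using congrArg (eval 0) h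
    simpa using inj.ne this
  refine exists_congr fun h => ?_
  rw [← inj.eq_iff]
  simp only [jacobiOperator, LinearMap.coe_mk, AddHom.coe_mk, AlgHom.toLinearMap_apply,
    IsScalarTower.coe_toAlgHom', map_mul, map_add, map_sub, map_one, map_pow,
    RatFunc.algebraMap_X, RatFunc.algebraMap_C]
  have h3 : (1 - RatFunc.X ^ 2 : RatFunc ℂ) = (1 - RatFunc.X) * (1 + RatFunc.X) := by ring
  have h4 : (1 - RatFunc.X ^ 2 : RatFunc ℂ) ≠ 0 := h3 ▸ mul_ne_zero h1 h2
  rw [← mul_right_inj' h4]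
  refine Eq.congr_left ?_
  rw [h3]
  field_simp

theorem jacobiWeighted_mem_imPrime (α β : ℝ) (y : ℂ[X]) :
    jacobiWeighted α β y ∈ imPrime (jacobiOperator α β) := by
  rw [mem_imPrime_jacobiOperator]
  refine ⟨(1 - X ^ 2) * y, ?_⟩
  rw [jacobiWeighted_apply]
  ring

/-! ### The local exponents at the zeros of a polynomial -/

theorem rootMultiplicity_one_sub_X_sq_le (s : ℂ) : (1 - X ^ 2 : ℂ[X]).rootMultiplicity s ≤ 1 := by
  have h0 : (1 - X ^ 2 : ℂ[X]) ≠ 0 := fun h => by simpa using congrArg (eval 0) h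
  by_contra! h
  obtain ⟨h1, h2⟩ := (one_lt_rootMultiplicity_iff_isRoot h0).1 h
  have : s = 0 := by simpa using h2
  simp [this] at h1

/-- After multiplication by a polynomial `h(f)` with `h(0) ≠ 0`, that is, by a unit near the zeros
of `f`, the quotient `f / (f' (1 - t ^ 2))` becomes a polynomial `b`. -/
theorem exists_mul_derivative_mul_eq_mul_comp {f : ℂ[X]} (hf : derivative f ≠ 0) :
    ∃ h b : ℂ[X], b * (derivative f * (1 - X ^ 2)) = f * h.comp f ∧ h.eval 0 ≠ 0 := by
  classical
  have hf0 : f ≠ 0 := by rintro rfl; simp at hf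
  have hX : (1 - X ^ 2 : ℂ[X]) ≠ 0 := fun h => by simpa using congrArg (eval 0) h
  set E := derivative f * (1 - X ^ 2) with hE
  have hE0 : E ≠ 0 := mul_ne_zero hf hX
  set R₀ := E.roots.filter (fun s => f.eval s = 0)
  -- The roots of `E` away from the zeros of `f` are cancelled by the factors `f - f(s)` of `h(f)`.
  set R₁ := E.roots.filter (fun s => ¬ f.eval s = 0)
  set h : ℂ[X] := (R₁.map fun s => X - C (f.eval s)).prod with hh
  -- A zero `s` of `f` has one multiplicity less in `f'`, and `1 - X ^ 2` adds at most one.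
  have d₀ : (R₀.map fun s => X - C s).prod ∣ f := by
    refine (Multiset.prod_X_sub_C_dvd_iff_le_roots hf0 _).2 (Multiset.le_iff_count.2 fun s => ?_)
    rw [Multiset.count_filter, count_roots, count_roots]
    split_ifs with hs
    · rw [rootMultiplicity_mul hE0, derivative_rootMultiplicity_of_root hs]
      have := (rootMultiplicity_pos hf0).2 hs
      have := rootMultiplicity_one_sub_X_sq_le s
      omega
    · exact Nat.zero_le _
  have d₁ : (R₁.map fun s => X - C s).prod ∣ h.comp f := by
    have : h.comp f = (R₁.map fun s => f - C (f.eval s)).prod := by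
      rw [hh, multiset_prod_comp, Multiset.map_map]
      simp
    rw [this]
    exact Multiset.prod_dvd_prod_of_dvd _ _ fun s _ => X_sub_C_dvd_sub_C_eval
  have hEdvd : E ∣ f * h.comp f := by
    rw [(IsAlgClosed.splits E).eq_prod_roots, ← Multiset.filter_add_not (fun s => f.eval s = 0)
      E.roots, Multiset.map_add, Multiset.prod_add]
    exact (C_mul_dvd (leadingCoeff_ne_zero.2 hE0)).2 (mul_dvd_mul d₀ d₁)
  obtain ⟨b, hb⟩ := hEdvd
  refine ⟨h, b, by rw [hb, mul_comm], ?_⟩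
  rw [hh, eval_multiset_prod, Multiset.map_map]
  refine Multiset.prod_ne_zero fun h0 => ?_
  obtain ⟨s, hs, hs0⟩ := Multiset.mem_map.1 h0
  exact (Multiset.mem_filter.1 hs).2 (by simpa using hs0)

/-- The eigenvalues of `g ↦ D ((1 - t ^ 2) b g)` on `ℂ[t] / (f)` are positive multiples of `h(0)`.
At a zero `r` of `f` of multiplicity `e`, the operator multiplies the lowest term `(t - r) ^ j` of
an eigenvector by `h(0) (j + 1 + c) / e`, where `c` is the exponent of the Jacobi weight
`(1 - t) ^ α (1 + t) ^ β` at `r`; here `c > -1`. -/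
theorem exists_eigenvalue_eq_of_dvd {α β : ℝ} (hα : -1 < α) (hβ : -1 < β) {f g h b : ℂ[X]}
    (hf : f ≠ 0) (hb : b * (derivative f * (1 - X ^ 2)) = f * h.comp f) {μ : ℂ}
    (hfg : ¬ f ∣ g) (hdvd : f ∣ jacobiWeighted α β (b * g) - C μ * g) :
    ∃ c : ℝ, 0 < c ∧ μ = c * h.eval 0 := by
  have hg : g ≠ 0 := by rintro rfl; simp at hfg
  obtain ⟨r, hr⟩ : ∃ r, g.rootMultiplicity r < f.rootMultiplicity r := by
    by_contra! H
    refine hfg ((IsAlgClosed.splits f).dvd_of_roots_le_roots hf ?_)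
    classical
    exact Multiset.le_iff_count.2 fun s => by simpa using H s
  obtain ⟨f₀, hf₀, hf₀r⟩ := f.exists_eq_pow_rootMultiplicity_mul_and_not_dvd hf r
  obtain ⟨g₀, hg₀, hg₀r⟩ := g.exists_eq_pow_rootMultiplicity_mul_and_not_dvd hg r
  rw [dvd_iff_isRoot, IsRoot.def] at hf₀r hg₀r
  set j := g.rootMultiplicity r
  obtain ⟨e, he⟩ : ∃ e, f.rootMultiplicity r = e + 1 :=
    ⟨_, (Nat.succ_pred_eq_of_pos (by omega)).symm⟩
  rw [he] at hr hf₀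
  have hXr : (X - C r : ℂ[X]) ≠ 0 := X_sub_C_ne_zero r
  have hB : (1 - X ^ 2) * b * (C (e + 1 : ℂ) * f₀ + (X - C r) * derivative f₀)
      = (X - C r) * (f₀ * h.comp f) := by
    refine mul_left_cancel₀ (pow_ne_zero e hXr) ?_
    have h1 : derivative f = (X - C r) ^ e * (C (e + 1 : ℂ) * f₀ + (X - C r) * derivative f₀) := by
      conv_lhs => rw [hf₀]
      rw [derivative_mul, derivative_X_sub_C_pow]
      simp
      ring
    calc _ = b * (derivative f * (1 - X ^ 2)) := by rw [h1]; ring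
      _ = (X - C r) ^ (e + 1) * f₀ * h.comp f := by rw [hb, ← hf₀]
      _ = _ := by ring
  have he1 : (e + 1 : ℂ) ≠ 0 := by exact_mod_cast e.succ_ne_zero
  have hBr : (1 - r ^ 2) * b.eval r = 0 := by
    have := congrArg (eval r) hB
    simpa [hf₀r, he1] using this
  -- `(1 - X ^ 2) b = f h(f) / f'` has a simple zero at `r`, with derivative `h(0) / (e + 1)`.
  obtain ⟨b₁, hb₁⟩ : X - C r ∣ (1 - X ^ 2) * b := by
    rw [dvd_iff_isRoot]
    simpa using hBr
  have hfr : f.eval r = 0 := by rw [hf₀]; simp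
  have hb₁r : (e + 1) * b₁.eval r = h.eval 0 := by
    have : b₁ * (C (e + 1 : ℂ) * f₀ + (X - C r) * derivative f₀) = f₀ * h.comp f := by
      refine mul_left_cancel₀ hXr ?_
      rw [← hB, hb₁]
      ring
    have := congrArg (eval r) this
    simp [hfr] at this
    refine mul_left_cancel₀ hf₀r ?_
    linear_combination this
  -- `c` is the exponent of the weight at `r`: `α` at `1`, `β` at `-1` and `0` elsewhere.
  obtain ⟨c, hc, y, hy⟩ : ∃ c : ℝ, -1 < c ∧ ∃ y : ℂ[X],
      -C (α : ℂ) * (1 + X) * b + C (β : ℂ) * (1 - X) * b = C (c : ℂ) * b₁ + (X - C r) * y := by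
    by_cases h1 : r = 1
    · subst h1
      have : b₁ = -(1 + X) * b := by
        refine mul_left_cancel₀ hXr ?_
        rw [← hb₁, C_1]
        ring
      exact ⟨α, hα, -C (β : ℂ) * b, by rw [this, C_1]; ring⟩
    by_cases h2 : r = -1
    · subst h2
      have : b₁ = (1 - X) * b := by
        refine mul_left_cancel₀ hXr ?_
        rw [← hb₁, C_neg, C_1]
        ring
      exact ⟨β, hβ, -C (α : ℂ) * b, by rw [this, C_neg, C_1]; ring⟩
    have h3 : (1 - r ^ 2) ≠ 0 := fun h3 => by
      have : (r - 1) * (r + 1) = 0 := by linear_combination -h3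
      rcases mul_eq_zero.1 this with h | h
      · exact h1 (sub_eq_zero.1 h)
      · exact h2 (eq_neg_of_add_eq_zero_left h)
    obtain ⟨b₂, hb₂⟩ : X - C r ∣ b :=
      dvd_iff_isRoot.2 ((mul_eq_zero.1 hBr).resolve_left h3)
    refine ⟨0, by norm_num, (-C (α : ℂ) * (1 + X) + C (β : ℂ) * (1 - X)) * b₂, ?_⟩
    rw [hb₂]
    simp
    ring
  have key : jacobiWeighted α β (b * g) - C μ * g = (X - C r) ^ j *
      ((C (j + 1 + c : ℂ) * b₁ - C μ) * g₀ + (X - C r) * (derivative (b₁ * g₀) + y * g₀)) := by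
    have h1 : (1 - X ^ 2) * (b * g) = (X - C r) ^ (j + 1) * (b₁ * g₀) := by
      rw [← mul_assoc, hb₁]
      conv_lhs => rw [hg₀]
      ring
    rw [jacobiWeighted_apply, h1, derivative_mul, derivative_X_sub_C_pow]
    simp only [map_add, Nat.add_sub_cancel, Nat.cast_add, map_natCast, Nat.cast_one, C_1]
    linear_combination (C (c : ℂ) * b₁ + (X - C r) * y - C μ) * hg₀ + g * hy
  have hroot : (X - C r) ∣ (C (j + 1 + c : ℂ) * b₁ - C μ) * g₀ +
      (X - C r) * (derivative (b₁ * g₀) + y * g₀) := by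
    refine (mul_dvd_mul_iff_left (pow_ne_zero j hXr)).1 ?_
    rw [← key, ← pow_succ]
    refine dvd_trans (dvd_trans (pow_dvd_pow _ hr) ?_) hdvd
    exact ⟨f₀, hf₀⟩
  rw [dvd_iff_isRoot, IsRoot.def] at hroot
  have hμ : μ = (j + 1 + c) * b₁.eval r := by
    have : ((j + 1 + c) * b₁.eval r - μ) * g₀.eval r = 0 := by simpa using hroot
    exact (sub_eq_zero.1 ((mul_eq_zero.1 this).resolve_right hg₀r)).symm
  refine ⟨(j + 1 + c) / (e + 1), by have : (0 : ℝ) ≤ j := j.cast_nonneg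
                                    have : (0 : ℝ) < j + 1 + c := by linarith
                                    positivity, ?_⟩
  rw [hμ, ← hb₁r]
  push_cast
  field_simp

/-! ### The module of polynomials with eventually vanishing moments -/

/-- `ℂ[t]` is finite over `ℂ[f]`: `t` is a root of `f(T) - f`, whose leading coefficient is a
nonzero constant. -/
theorem isNoetherian_adjoin_singleton {f : ℂ[X]} (hf : f.natDegree ≠ 0) :
    IsNoetherian (Algebra.adjoin ℂ {f}) ℂ[X] := by
  have hf0 : f ≠ 0 := by rintro rfl; simp at hf
  set A := Algebra.adjoin ℂ {f}
  let F : A := ⟨f, Algebra.subset_adjoin rfl⟩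
  have : IsNoetherianRing A := by
    have : Algebra.FiniteType ℂ A :=
      A.fg_iff_finiteType.1 ⟨{f}, by simp [A]⟩
    exact Algebra.FiniteType.isNoetherianRing ℂ A
  have hX : IsIntegral A (X : ℂ[X]) := by
    set p : A[X] := f.map (algebraMap ℂ A) - C F with hp
    have hdeg : (C F).degree < (f.map (algebraMap ℂ A)).degree := by
      rw [degree_map]
      exact degree_C_le.trans_lt (natDegree_pos_iff_degree_pos.1 (Nat.pos_of_ne_zero hf))
    have hlc : p.leadingCoeff = algebraMap ℂ A f.leadingCoeff := by
      rw [hp, leadingCoeff_sub_of_degree_lt hdeg, leadingCoeff_map]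
    have hroot : aeval (X : ℂ[X]) p = 0 := by
      rw [hp, aeval_def, eval₂_sub, ← aeval_def, aeval_map_algebraMap, aeval_X_left_apply, eval₂_C]
      exact sub_self f
    have h := (isIntegral_leadingCoeff_smul p X hroot).smul (algebraMap ℂ A f.leadingCoeff⁻¹)
    rwa [hlc, smul_smul, ← map_mul, inv_mul_cancel₀ (leadingCoeff_ne_zero.2 hf0), map_one,
      one_smul] at h
  have htop : Algebra.adjoin A {(X : ℂ[X])} = ⊤ := by
    refine top_unique fun q _ => ?_
    have hq : q ∈ Algebra.adjoin ℂ {(X : ℂ[X])} := by rw [adjoin_X]; trivial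
    induction hq using Algebra.adjoin_induction with
    | mem y hy => exact Algebra.subset_adjoin hy
    | algebraMap r => exact (Algebra.adjoin A _).algebraMap_mem (algebraMap ℂ A r)
    | add y z _ _ hy hz => exact add_mem (hy trivial) (hz trivial)
    | mul y z _ _ hy hz => exact mul_mem (hy trivial) (hz trivial)
  have hfin : Module.Finite A ℂ[X] := by
    refine ⟨?_⟩
    have := hX.fg_adjoin_singleton
    rwa [htop, Algebra.top_toSubmodule] at this
  exact isNoetherian_of_isNoetherianRing_of_finite A ℂ[X]

/-- The polynomials `g` such that `f ^ k * g ∈ V` for all `k ≥ n`, as a module over `ℂ[f]`. -/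
def eventuallyMem (V : Submodule ℂ ℂ[X]) (f : ℂ[X]) (n : ℕ) :
    Submodule (Algebra.adjoin ℂ {f}) ℂ[X] where
  carrier := {g | ∀ k, n ≤ k → f ^ k * g ∈ V}
  zero_mem' k _ := by simp
  add_mem' hx hy k hk := by
    rw [mul_add]
    exact V.add_mem (hx k hk) (hy k hk)
  smul_mem' := by
    rintro ⟨a, ha⟩ x hx
    change ∀ k, n ≤ k → f ^ k * (a * x) ∈ V
    induction ha using Algebra.adjoin_induction generalizing x with
    | mem y hy =>
      intro k hk
      rw [Set.mem_singleton_iff.1 hy, ← mul_assoc, ← pow_succ]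
      exact hx _ (by omega)
    | algebraMap r =>
      intro k hk
      rw [← Algebra.smul_def, mul_smul_comm]
      exact V.smul_mem _ (hx k hk)
    | add y z _ _ hy hz =>
      intro k hk
      rw [add_mul, mul_add]
      exact V.add_mem (hy hx k hk) (hz hx k hk)
    | mul y z _ _ hy hz =>
      intro k hk
      rw [mul_assoc]
      exact hy (hz hx) k hk

theorem mem_eventuallyMem {V : Submodule ℂ ℂ[X]} {f g : ℂ[X]} {n : ℕ} :
    g ∈ eventuallyMem V f n ↔ ∀ k, n ≤ k → f ^ k * g ∈ V :=
  Iff.rfl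

theorem eventuallyMem_mono (V : Submodule ℂ ℂ[X]) (f : ℂ[X]) : Monotone (eventuallyMem V f) :=
  fun _ _ hmn _ hg k hk => hg k (hmn.trans hk)

theorem mul_mem_eventuallyMem_iff {V : Submodule ℂ ℂ[X]} {f g : ℂ[X]} {n : ℕ} :
    f * g ∈ eventuallyMem V f n ↔ g ∈ eventuallyMem V f (n + 1) := by
  simp only [mem_eventuallyMem, ← mul_assoc, ← pow_succ]
  refine ⟨fun H k hk => ?_, fun H k hk => H _ (by omega)⟩
  obtain ⟨k, rfl⟩ : ∃ l, k = l + 1 := ⟨k - 1, by omega⟩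
  exact H k (by omega)

theorem comp_mul_mem_eventuallyMem {V : Submodule ℂ ℂ[X]} {f g : ℂ[X]} {n : ℕ}
    (hg : g ∈ eventuallyMem V f n) (q : ℂ[X]) : q.comp f * g ∈ eventuallyMem V f n :=
  (eventuallyMem V f n).smul_mem
    (⟨q.comp f, by
      exact aeval_mem_adjoin_singleton ℂ f⟩ : Algebra.adjoin ℂ {f}) hg

/-- An integration by parts: `S g = D ((1 - t ^ 2) b g)` satisfies
`f ^ k S g + k f ^ k h(f) g ∈ V`. For `k = n` and `g` as below, `h(f)` may be replaced by `h(0)`,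
because `f ^ n (h(f) - h(0)) g` is a multiple of `f ^ (n + 1) g` by an element of `ℂ[f]`. -/
theorem jacobiWeighted_add_mem {V : Submodule ℂ ℂ[X]} {α β : ℝ}
    (hV : ∀ y, jacobiWeighted α β y ∈ V) {f h b g : ℂ[X]} {n : ℕ}
    (hb : b * (derivative f * (1 - X ^ 2)) = f * h.comp f) (hg : g ∈ eventuallyMem V f (n + 1)) :
    jacobiWeighted α β (b * g) + C (n * h.eval 0) * g ∈ eventuallyMem V f n := by
  have hS : ∀ k : ℕ, f ^ k * jacobiWeighted α β (b * g) + (k : ℂ) • (f ^ k * (h.comp f * g)) ∈ V := by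
    intro k
    convert hV (f ^ k * (b * g)) using 1
    rw [jacobiWeighted_mul α β (f ^ k), derivative_pow, smul_eq_C_mul]
    rcases k with _ | k
    · simp
    · rw [Nat.add_sub_cancel]
      linear_combination (-(C ((k + 1 : ℕ) : ℂ)) * f ^ k * g) * hb
  have hhg := comp_mul_mem_eventuallyMem hg h
  intro k hk
  rw [mul_add]
  rcases hk.eq_or_lt with rfl | hk
  · have hd : f ^ n * (h.comp f * g - C (h.eval 0) * g) ∈ V := by
      have h1 : h.comp f = f * h.divX.comp f + C (h.eval 0) := by
        conv_lhs => rw [← h.X_mul_divX_add]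
        simp [coeff_zero_eq_eval_zero]
      have h2 : f ^ n * (h.comp f * g - C (h.eval 0) * g) = f ^ (n + 1) * (h.divX.comp f * g) := by
        rw [h1]; ring
      rw [h2]
      exact comp_mul_mem_eventuallyMem hg _ _ le_rfl
    convert V.sub_mem (hS n) (V.smul_mem (n : ℂ) hd) using 1
    simp only [smul_eq_C_mul, C_mul]
    ring
  · refine V.add_mem ?_ ?_
    · convert V.sub_mem (hS k) (V.smul_mem (k : ℂ) (hhg k hk)) using 1
      ring
    · rw [mul_left_comm, ← smul_eq_C_mul]
      exact V.smul_mem _ (hg k hk)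

/-- If almost all powers of a nonconstant polynomial lie in a subspace that contains
`D ((1 - t ^ 2) ℂ[t])`, then so does the power with exponent `0`. -/
theorem one_mem_of_pow_mem {V : Submodule ℂ ℂ[X]} {α β : ℝ} (hα : -1 < α) (hβ : -1 < β)
    (hV : ∀ y, jacobiWeighted α β y ∈ V) {f : ℂ[X]} (hf : f.natDegree ≠ 0) {N : ℕ}
    (hN : ∀ m, N ≤ m → f ^ m ∈ V) : (1 : ℂ[X]) ∈ V := by
  have hf0 : f ≠ 0 := by rintro rfl; simp at hf
  have hf' : derivative f ≠ 0 := fun h => hf (derivative_eq_zero.1 h)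
  obtain ⟨h, b, hb, hh⟩ := exists_mul_derivative_mul_eq_mul_comp hf'
  have := isNoetherian_adjoin_singleton hf
  have hex : ∃ n, ∀ m, eventuallyMem V f m ≤ eventuallyMem V f n := by
    obtain ⟨n, hn⟩ := monotone_stabilizes_iff_noetherian.mpr this
      ⟨eventuallyMem V f, eventuallyMem_mono V f⟩
    refine ⟨n, fun m => ?_⟩
    rcases le_total n m with hnm | hnm
    · exact (hn m hnm).ge
    · exact eventuallyMem_mono V f hnm
  -- Take the least `n` at which the chain becomes constant; the claim is that it is `0`.
  classical
  have hn := Nat.find_spec hex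
  have hmin := fun {m} => Nat.find_min hex (m := m)
  generalize Nat.find hex = n at hn hmin
  rcases n with _ | n
  · have : (1 : ℂ[X]) ∈ eventuallyMem V f N := fun k hk => by simpa using hN k hk
    simpa using hn N this 0 le_rfl
  exfalso
  obtain ⟨g₁, hg₁, hg₁'⟩ : ∃ g ∈ eventuallyMem V f (n + 1), g ∉ eventuallyMem V f n := by
    by_contra! H
    exact hmin n.lt_succ_self fun m => (hn m).trans H
  let T : ℂ[X] →ₗ[ℂ] ℂ[X] := (jacobiWeighted α β).comp (LinearMap.mulLeft ℂ b) +
    (n * h.eval 0) • LinearMap.id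
  have hTa : ∀ g, T g = jacobiWeighted α β (b * g) + C (n * h.eval 0) * g := fun g => by
    simp [T, smul_eq_C_mul]
  let I : Submodule ℂ ℂ[X] := (Ideal.span {f}).restrictScalars ℂ
  have hI : ∀ x, x ∈ I ↔ f ∣ x := fun x => Ideal.mem_span_singleton
  have hTI : I ≤ I.comap T := by
    intro x hx
    obtain ⟨x, rfl⟩ := (hI x).1 hx
    rw [Submodule.mem_comap, hI, hTa, mul_left_comm b, jacobiWeighted_mul]
    refine ⟨jacobiWeighted α β (b * x) + h.comp f * x + C (n * h.eval 0) * x, ?_⟩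
    linear_combination x * hb
  have : FiniteDimensional ℂ (ℂ[X] ⧸ I) := by
    have : Module.Finite ℂ (ℂ[X] ⧸ Ideal.span {f}) := (AdjoinRoot.powerBasis hf0).finite
    exact Module.Finite.equiv (Submodule.Quotient.restrictScalarsEquiv ℂ (Ideal.span {f})).symm
  let J : Submodule ℂ ℂ[X] := (eventuallyMem V f (n + 1)).restrictScalars ℂ
  have hTJ : ∀ g ∈ J, T g ∈ eventuallyMem V f n := fun g hg => by
    rw [hTa]
    exact jacobiWeighted_add_mem hV hb hg
  let U := J.map I.mkQ
  have hTU : ∀ u ∈ U, I.mapQ I T hTI u ∈ U := by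
    rintro _ ⟨g, hg, rfl⟩
    exact ⟨T g, eventuallyMem_mono V f n.le_succ (hTJ g hg), rfl⟩
  let TU : U →ₗ[ℂ] U := (I.mapQ I T hTI).restrict hTU
  -- The image of `TU` comes from the proper submodule at level `n`, which contains `I ∩ J`.
  have hsurj : ¬ Function.Surjective TU := by
    intro hs
    obtain ⟨⟨_, g, hg, rfl⟩, hu⟩ := hs ⟨I.mkQ g₁, g₁, hg₁, rfl⟩
    have h1 : I.mkQ (T g) = I.mkQ g₁ := congrArg Subtype.val hu
    have h2 : g₁ - T g ∈ I := by
      rw [← Submodule.Quotient.mk_eq_zero, Submodule.Quotient.mk_sub]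
      exact sub_eq_zero.2 h1.symm
    obtain ⟨x, hx⟩ := (hI _).1 h2
    have hTg := hTJ g hg
    have h3 : f * x ∈ eventuallyMem V f (n + 1) := by
      rw [← hx]
      exact sub_mem hg₁ (eventuallyMem_mono V f n.le_succ hTg)
    have h4 : f * x ∈ eventuallyMem V f n :=
      mul_mem_eventuallyMem_iff.2 (hn _ (mul_mem_eventuallyMem_iff.1 h3))
    refine hg₁' ?_
    rw [← sub_add_cancel g₁ (T g), hx]
    exact add_mem h4 hTg
  rw [← LinearMap.injective_iff_surjective, ← LinearMap.ker_eq_bot, Submodule.eq_bot_iff] at hsurj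
  push Not at hsurj
  obtain ⟨⟨_, g, hg, rfl⟩, hker, hne⟩ := hsurj
  have hfg : ¬ f ∣ g := fun hfg =>
    hne (Subtype.ext ((Submodule.Quotient.mk_eq_zero I).2 ((hI g).2 hfg)))
  have hdvd : f ∣ T g := (hI _).1 ((Submodule.Quotient.mk_eq_zero I).1 (congrArg Subtype.val hker))
  -- An eigenvector of `g ↦ D ((1 - t ^ 2) b g)` modulo `f` with eigenvalue `-n h(0)`, which is not
  -- a positive multiple of `h(0)`.
  obtain ⟨c, hc, hμ⟩ := exists_eigenvalue_eq_of_dvd hα hβ hf0 hb (μ := -(n * h.eval 0)) hfg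
    (by rw [hTa] at hdvd; simpa using hdvd)
  have h0 : ((c + n : ℝ) : ℂ) * h.eval 0 = 0 := by
    push_cast
    linear_combination -hμ
  have : c + n = 0 := by
    exact_mod_cast (mul_eq_zero.1 h0).resolve_right hh
  have : (0 : ℝ) ≤ n := n.cast_nonneg
  linarith

/-! ### The Strong Image Conjecture for Jacobi operators -/

/-- The Strong Image Conjecture holds for all real parameters `α, β > -1`, integral or not. -/
theorem strongImageConjectureFor_jacobiOperator {α β : ℝ} (hα : -1 < α) (hβ : -1 < β) :
    StrongImageConjectureFor (jacobiOperator α β) := by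
  intro h1
  refine Set.eq_singleton_iff_unique_mem.2 ⟨⟨1, fun m hm => ?_⟩, ?_⟩
  · rw [zero_pow (by omega)]
    exact zero_mem _
  rintro a ⟨N, hN⟩
  by_contra ha
  refine h1 ?_
  by_cases hd : a.natDegree = 0
  · obtain ⟨c, rfl⟩ := natDegree_eq_zero.1 hd
    have hc : c ≠ 0 := by rintro rfl; simp at ha
    have := Submodule.smul_mem _ (c ^ N)⁻¹ (hN N le_rfl)
    rwa [← C_pow, smul_C, smul_eq_mul, inv_mul_cancel₀ (pow_ne_zero _ hc), C_1] at this
  · exact one_mem_of_pow_mem hα hβ (jacobiWeighted_mem_imPrime α β) hd hN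

/-- If `D h = 1`, then `h` vanishes at `1` and `-1`, so its degree `n` is at least `2`; the leading
coefficient of `(1 - t ^ 2) D h` is then `-(n + α + β)` times that of `h`, in degree `n + 1 > 2`. -/
theorem one_notMem_imPrime_jacobiOperator {α β : ℝ} (hα : -1 < α) (hβ : -1 < β) (hα0 : α ≠ 0)
    (hβ0 : β ≠ 0) : (1 : ℂ[X]) ∉ imPrime (jacobiOperator α β) := by
  rw [mem_imPrime_jacobiOperator]
  rintro ⟨h, hh⟩
  have e1 : h.eval 1 = 0 := by
    have := congrArg (eval 1) hh
    simpa [hα0, one_add_one_eq_two] using this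
  have e2 : h.eval (-1) = 0 := by
    have := congrArg (eval (-1)) hh
    simpa [hβ0, one_add_one_eq_two] using this
  have hh0 : h ≠ 0 := by
    rintro rfl
    simpa using congrArg (eval 0) hh
  obtain ⟨n, hn⟩ : ∃ n, h.natDegree = n + 2 := by
    obtain ⟨h', rfl⟩ := dvd_iff_isRoot.2 e1
    have e3 : h'.eval (-1) = 0 := by
      simp at e2
      rcases e2 with h | h
      · norm_num at h
      · exact h
    obtain ⟨h'', rfl⟩ := dvd_iff_isRoot.2 e3
    refine ⟨h''.natDegree, ?_⟩
    have : h'' ≠ 0 := by rintro rfl; simp at hh0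
    rw [natDegree_mul (X_sub_C_ne_zero _) (mul_ne_zero (X_sub_C_ne_zero _) this),
      natDegree_mul (X_sub_C_ne_zero _) this, natDegree_X_sub_C, natDegree_X_sub_C]
    ring
  -- The degree of `h` is `n + 2`, so the top degree on the left is `n + 3`.
  have hc := congrArg (fun p => coeff p (n + 3)) hh
  have z1 : h.coeff (n + 3) = 0 := coeff_eq_zero_of_natDegree_lt (by omega)
  have z2 : h.coeff (n + 4) = 0 := coeff_eq_zero_of_natDegree_lt (by omega)
  have hne : h.coeff (n + 2) ≠ 0 := by
    rw [← hn]
    exact leadingCoeff_ne_zero.2 hh0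
  simp [sub_mul, mul_assoc, add_mul, coeff_X_pow_mul', coeff_derivative, coeff_one, z1, z2] at hc
  have h0 : ((n + 2 + α + β : ℝ) : ℂ) * h.coeff (n + 2) = 0 := by
    push_cast
    linear_combination -hc
  have : (n + 2 + α + β : ℝ) = 0 := by
    exact_mod_cast (mul_eq_zero.1 h0).resolve_right hne
  have : (0 : ℝ) ≤ n := n.cast_nonneg
  linarith

theorem corollary6p9 :
    -- Both parameters natural numbers, not both zero.
    (∀ α β : ℝ, ¬ (α = 0 ∧ β = 0) → (∃ a : ℕ, α = a) → (∃ b : ℕ, β = b) →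
      StrongImageConjectureFor (jacobiOperator α β) ∧
      (α ≠ 0 → β ≠ 0 → powerRadical (imPrime (jacobiOperator α β) : Set ℂ[X]) = {0})) ∧
    -- Equal parameters `lam - 1/2` with `lam` a half of a natural number, not both zero.
    (∀ α β : ℝ, ¬ (α = 0 ∧ β = 0) →
      ∀ lam : ℝ, (∃ n : ℕ, lam = n / 2) → α = lam - 1 / 2 → β = lam - 1 / 2 →
      StrongImageConjectureFor (jacobiOperator α β) ∧
      powerRadical (imPrime (jacobiOperator α β) : Set ℂ[X]) = {0}) ∧
    -- Gegenbauer polynomials with `lam ≥ 1`.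
    (∀ lam : ℝ, (∃ n : ℕ, lam = n / 2) → 1 ≤ lam →
      StrongImageConjectureFor (gegenbauerOperator lam)) ∧
    -- Chebyshev polynomials of the first and of the second kind.
    StrongImageConjectureFor (gegenbauerOperator 0) ∧
    StrongImageConjectureFor (gegenbauerOperator 1) := by
  have rad {α β : ℝ} (hα : -1 < α) (hβ : -1 < β) (hα0 : α ≠ 0) (hβ0 : β ≠ 0) :
      powerRadical (imPrime (jacobiOperator α β) : Set ℂ[X]) = {0} :=
    strongImageConjectureFor_jacobiOperator hα hβ
      (one_notMem_imPrime_jacobiOperator hα hβ hα0 hβ0)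
  refine ⟨?_, ?_, fun lam _ hlam => ?_, ?_, ?_⟩
  · rintro α β - ⟨a, rfl⟩ ⟨b, rfl⟩
    have ha : (-1 : ℝ) < a := by linarith [a.cast_nonneg (α := ℝ)]
    have hb : (-1 : ℝ) < b := by linarith [b.cast_nonneg (α := ℝ)]
    exact ⟨strongImageConjectureFor_jacobiOperator ha hb, rad ha hb⟩
  · rintro α β h0 lam ⟨n, rfl⟩ rfl rfl
    have hn : (-1 : ℝ) < n / 2 - 1 / 2 := by linarith [n.cast_nonneg (α := ℝ)]
    have hne : (n / 2 - 1 / 2 : ℝ) ≠ 0 := fun h => h0 ⟨h, h⟩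
    exact ⟨strongImageConjectureFor_jacobiOperator hn hn, rad hn hn hne hne⟩
  all_goals exact strongImageConjectureFor_jacobiOperator (by linarith) (by linarith)
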